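/- There is an absolute constant $c$ such that the following holds for every $n$. Every binary tree $T$ with $n$ vertices (a rooted tree in which each node has at most a left and a right child) has a planar straight-line orthogonal grid drawing of area at most $n\,2^{c\log^* n}$, i.e. of area $n\,2^{O(\log^* n)}$. Here $\log^* n$ is the iterated logarithm, the least $k\ge 0$ such that applying $\log_2$ to $n$ successively $k$ times gives a value at most $1$. A planar straight-line orthogonal grid drawing maps the vertices of $T$ to distinct points of an integer grid $\{1,\dots,W\}\times\{1,\dots,H\}$ and draws each edge as the straight segment between the images of its endpoints, so that every edge is horizontal or vertical, no edge passes through a vertex other than its endpoints, and two distinct edges meet at most at a common endpoint; its area is $W\cdot H$. (The order of the two children need not be respected by the drawing.) -/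

import Mathlib

noncomputable section

namespace TreeDrawing

/-- The binary logarithm applied `k` times. -/
def iterLog (k : ℕ) (x : ℝ) : ℝ := (Real.logb 2)^[k] x

/-- The iterated logarithm `log* x`: the least number of times that the binary logarithm has to be
applied, starting from `x`, to reach a value that is at most `1`. -/
def logStar (x : ℝ) : ℕ := sInf {k : ℕ | iterLog k x ≤ 1}

/-- The set in the definition of `logStar` is never empty. -/
theorem exists_iterLog_le_one (x : ℝ) : ∃ k : ℕ, iterLog k x ≤ 1 := by
  suffices h : ∀ n : ℕ, ∀ x : ℝ, x ≤ n → ∃ k : ℕ, iterLog k x ≤ 1 by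
    obtain ⟨n, hn⟩ := exists_nat_ge x
    exact h n x hn
  intro n
  induction n with
  | zero =>
    intro x hx
    refine ⟨0, ?_⟩
    simp only [iterLog, Function.iterate_zero, id]
    push_cast at hx
    linarith
  | succ n ih =>
    intro x hx
    rcases le_or_gt x 1 with h1 | h1
    · exact ⟨0, by simpa [iterLog] using h1⟩
    · have hn : Real.logb 2 x ≤ n := by
        rw [Real.logb_le_iff_le_rpow (by norm_num) (by linarith), Real.rpow_natCast]
        have h2 : n + 1 ≤ 2 ^ n := Nat.lt_two_pow_self
        have h3 : ((n + 1 : ℕ) : ℝ) ≤ 2 ^ n := by exact_mod_cast h2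
        linarith
      obtain ⟨k, hk⟩ := ih _ hn
      exact ⟨k + 1, by simpa [iterLog, Function.iterate_succ_apply] using hk⟩

/-- A word in `{false, true}` (`false`: go to the left child, `true`: go to the right child), read
from the root downwards, leads to a node of the binary tree `t`. -/
def IsNode : BinaryTree Unit → List Bool → Prop
  | .nil, _ => False
  | .node _ _ _, [] => True
  | .node _ l _, false :: p => IsNode l p
  | .node _ _ r, true :: p => IsNode r p

/-- The nodes of a binary tree, each represented by the path from the root to it. -/
def Vertex (t : BinaryTree Unit) : Type := {p : List Bool // IsNode t p}

/-- `w` is a child of `v`. -/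
def IsChild {t : BinaryTree Unit} (w v : Vertex t) : Prop :=
  ∃ b : Bool, w.1 = v.1 ++ [b]

/-- The underlying graph of a binary tree: its edges join the nodes to their children. -/
def treeGraph (t : BinaryTree Unit) : SimpleGraph (Vertex t) where
  Adj v w := IsChild w v ∨ IsChild v w
  symm := ⟨fun _ _ h => h.symm⟩
  loopless := ⟨by rintro v (⟨b, h⟩ | ⟨b, h⟩) <;> simp at h⟩

variable {V : Type*}

/-- A grid point, as a point of the real plane. -/
def toPlane (p : ℤ × ℤ) : ℝ × ℝ := ((p.1 : ℝ), (p.2 : ℝ))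

/-- The closed line segment between the positions of `u` and `v`. -/
def edgeSegment (pos : V → ℤ × ℤ) (u v : V) : Set (ℝ × ℝ) :=
  segment ℝ (toPlane (pos u)) (toPlane (pos v))

/-- `pos` is a planar straight-line drawing of the graph `G` on the grid
`{1, …, W} × {1, …, H}`. -/
structure IsPlanarStraightLineDrawing (G : SimpleGraph V) (W H : ℕ) (pos : V → ℤ × ℤ) :
    Prop where
  /-- vertices are mapped to points of the grid -/
  mem_grid : ∀ v, pos v ∈ Set.Icc (1 : ℤ) W ×ˢ Set.Icc (1 : ℤ) H
  /-- distinct vertices are mapped to distinct points -/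
  injective : Function.Injective pos
  /-- an edge passes through no vertex other than its two endpoints -/
  vertex_on_edge : ∀ u v w, G.Adj u v → toPlane (pos w) ∈ edgeSegment pos u v → w = u ∨ w = v
  /-- two distinct edges meet at most in (the position of) a common endpoint -/
  no_crossing : ∀ u v x y, G.Adj u v → G.Adj x y → s(u, v) ≠ s(x, y) →
    ∀ p ∈ edgeSegment pos u v ∩ edgeSegment pos x y,
      ∃ w, w ∈ s(u, v) ∧ w ∈ s(x, y) ∧ p = toPlane (pos w)

/-- All edges are drawn as vertical or horizontal segments. -/
def IsOrthogonal (G : SimpleGraph V) (pos : V → ℤ × ℤ) : Prop :=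
  ∀ u v, G.Adj u v → (pos u).1 = (pos v).1 ∨ (pos u).2 = (pos v).2

end TreeDrawing

end

/-! Planarity is encoded discretely: the half-open grid segments from the nodes to their parents are
disjoint (`Drawn`). Rounding a hypothetical crossing point shows that this suffices.

Draw the spine, which always descends to a larger child, along the top row and hang the other
subtrees below it. Each of these has fewer than half of the nodes, so the recursion costs one extra
row per halving. To keep the width small, suppose that all trees with fewer than `2 * b` nodes fit
into `S × L` boxes (`Fits`). Consecutive hanging trees with fewer than `b` nodes are grouped up to
total size below `2 * b`, and each group takes O(`S`) columns. A group is a stretch of the spine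
that must start and end in the top row. It is cut into two paths drawn from corner to corner, the
second one reflected, which is why `Fits` also speaks of paths. A tree with `n ≥ b` nodes, `n < 2 ^
j`, then gets height `L + j` and width O(`S * n / b`) (`Fits.exists_treeInBox_of_le`).

For `j = 2 * L` the height is only `3 * L`, so the area per node exceeds `S * L / b` by at most a
constant factor. The transposed boxes serve as the hypothesis for the next round (`Fits.next`),
whose `L` is at least `2 ^ L`. Hence about `log* n` rounds are enough, each costing a constant
factor. -/

/-! ### The discrete model of drawings -/

namespace TreeDrawing

/-- Two grid points lie on a common horizontal or vertical line. -/
def Aligned (p q : ℤ × ℤ) : Prop := p.1 = q.1 ∨ p.2 = q.2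

/-- For aligned points `q` and `e`, the grid points of the segment from `q` to `e`, without `e`
unless `q = e`. -/
def halfSegment (q e : ℤ × ℤ) : Set (ℤ × ℤ) :=
  {z | z = q ∨ (z ≠ e ∧ (min q.1 e.1 ≤ z.1 ∧ z.1 ≤ max q.1 e.1) ∧
    (min q.2 e.2 ≤ z.2 ∧ z.2 ≤ max q.2 e.2))}

/-- The tree can be drawn with its root at `e`, using only grid points of `R`, in such a way that
the half-open segments from the nodes to their parents are pairwise disjoint. -/
def Drawn : BinaryTree Unit → ℤ × ℤ → Set (ℤ × ℤ) → Prop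
  | .nil, _, _ => True
  | .node _ l r, e, R => e ∈ R ∧ ∃ A B, A ⊆ R ∧ B ⊆ R ∧ e ∉ A ∧ e ∉ B ∧ Disjoint A B ∧
      (l = .nil ∨ ∃ q A', Aligned q e ∧ Drawn l q A' ∧ A' ⊆ A ∧ halfSegment q e ⊆ A ∧
        ∀ z ∈ halfSegment q e, z ∈ A' → z = q) ∧
      (r = .nil ∨ ∃ q B', Aligned q e ∧ Drawn r q B' ∧ B' ⊆ B ∧ halfSegment q e ⊆ B ∧
        ∀ z ∈ halfSegment q e, z ∈ B' → z = q)

/-- The tree can be drawn below a parent at `e`, the drawing and the half-open edge to the parent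
using only grid points of `A`. -/
def Hangs (t : BinaryTree Unit) (e : ℤ × ℤ) (A : Set (ℤ × ℤ)) : Prop :=
  t = .nil ∨ ∃ q A', Aligned q e ∧ Drawn t q A' ∧ A' ⊆ A ∧ halfSegment q e ⊆ A ∧
    ∀ z ∈ halfSegment q e, z ∈ A' → z = q

theorem Drawn.mono {t : BinaryTree Unit} {e : ℤ × ℤ} {R R' : Set (ℤ × ℤ)} (h : Drawn t e R)
    (hR : R ⊆ R') : Drawn t e R' := by
  cases t with
  | nil => trivial
  | node a l r =>
    obtain ⟨he, A, B, hA, hB, h⟩ := h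
    exact ⟨hR he, A, B, hA.trans hR, hB.trans hR, h⟩

theorem Hangs.mono {t : BinaryTree Unit} {e : ℤ × ℤ} {A A' : Set (ℤ × ℤ)} (h : Hangs t e A)
    (hA : A ⊆ A') : Hangs t e A' := by
  rcases h with h | ⟨q, B, h1, h2, h3, h4, h5⟩
  · exact .inl h
  · exact .inr ⟨q, B, h1, h2, h3.trans hA, h4.trans hA, h5⟩

theorem Drawn.swap_children {l r : BinaryTree Unit} {e : ℤ × ℤ} {R : Set (ℤ × ℤ)}
    (h : Drawn (.node () l r) e R) : Drawn (.node () r l) e R := by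
  obtain ⟨he, A, B, hA, hB, heA, heB, hd, hl, hr⟩ := h
  exact ⟨he, B, A, hB, hA, heB, heA, hd.symm, hr, hl⟩

/-! ### Symmetries of the grid -/

/-- A permutation of the grid that respects alignment and segments. -/
def IsGridSymmetry (σ : ℤ × ℤ ≃ ℤ × ℤ) : Prop :=
  (∀ p q, Aligned p q ↔ Aligned (σ p) (σ q)) ∧
    ∀ q e z, z ∈ halfSegment q e ↔ σ z ∈ halfSegment (σ q) (σ e)

theorem IsGridSymmetry.symm {σ : ℤ × ℤ ≃ ℤ × ℤ} (h : IsGridSymmetry σ) :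
    IsGridSymmetry σ.symm :=
  ⟨fun p q => by rw [h.1 (σ.symm p)]; simp, fun q e z => by rw [h.2 (σ.symm q)]; simp⟩

theorem Hangs.map_of_drawn_map {σ : ℤ × ℤ ≃ ℤ × ℤ} (hσ : IsGridSymmetry σ) {t : BinaryTree Unit}
    (ht : ∀ {e : ℤ × ℤ} {R : Set (ℤ × ℤ)}, Drawn t e R → Drawn t (σ e) (σ.symm ⁻¹' R))
    {e : ℤ × ℤ} {A : Set (ℤ × ℤ)} (h : Hangs t e A) : Hangs t (σ e) (σ.symm ⁻¹' A) := by
  rcases h with h | ⟨q, A', h1, h2, h3, h4, h5⟩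
  · exact .inl h
  · have key : ∀ z ∈ halfSegment (σ q) (σ e), σ.symm z ∈ halfSegment q e := fun z hz => by
      rw [hσ.2]; simpa using hz
    refine .inr ⟨σ q, σ.symm ⁻¹' A', (hσ.1 _ _).1 h1, ht h2, Set.preimage_mono h3,
      fun z hz => h4 (key z hz), fun z hz hzA => ?_⟩
    rw [← h5 _ (key z hz) hzA]; simp

theorem Drawn.map {σ : ℤ × ℤ ≃ ℤ × ℤ} (hσ : IsGridSymmetry σ) {t : BinaryTree Unit} :
    ∀ {e : ℤ × ℤ} {R : Set (ℤ × ℤ)}, Drawn t e R → Drawn t (σ e) (σ.symm ⁻¹' R) := by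
  induction t with
  | nil => exact fun _ => trivial
  | node a l r ihl ihr =>
    rintro e R ⟨he, A, B, hA, hB, heA, heB, hd, hl, hr⟩
    exact ⟨by simpa using he, _, _, Set.preimage_mono hA, Set.preimage_mono hB, by simpa using heA,
      by simpa using heB, hd.preimage _, Hangs.map_of_drawn_map hσ ihl hl,
      Hangs.map_of_drawn_map hσ ihr hr⟩

theorem Hangs.map {σ : ℤ × ℤ ≃ ℤ × ℤ} (hσ : IsGridSymmetry σ) {t : BinaryTree Unit}
    {e : ℤ × ℤ} {A : Set (ℤ × ℤ)} (h : Hangs t e A) : Hangs t (σ e) (σ.symm ⁻¹' A) :=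
  h.map_of_drawn_map hσ (Drawn.map hσ)

/-- Translation. -/
def translate (a b : ℤ) : ℤ × ℤ ≃ ℤ × ℤ where
  toFun z := (z.1 + a, z.2 + b)
  invFun z := (z.1 - a, z.2 - b)
  left_inv z := by simp
  right_inv z := by simp

/-- Translation in the first coordinate, reflection in the second one. -/
def flip (a b : ℤ) : ℤ × ℤ ≃ ℤ × ℤ where
  toFun z := (z.1 + a, b - z.2)
  invFun z := (z.1 - a, b - z.2)
  left_inv z := by simp
  right_inv z := by simp

/-- Point reflection. -/
def rotate (a b : ℤ) : ℤ × ℤ ≃ ℤ × ℤ where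
  toFun z := (a - z.1, b - z.2)
  invFun z := (a - z.1, b - z.2)
  left_inv z := by simp
  right_inv z := by simp

theorem isGridSymmetry_translate (a b : ℤ) : IsGridSymmetry (translate a b) := by
  constructor
  · intro p q
    simp only [Aligned, translate, Equiv.coe_fn_mk]
    omega
  · intro q e z
    simp only [halfSegment, translate, Equiv.coe_fn_mk, Set.mem_ofPred_eq, Prod.ext_iff, ne_eq]
    omega

theorem isGridSymmetry_flip (a b : ℤ) : IsGridSymmetry (flip a b) := by
  constructor
  · intro p q
    simp only [Aligned, flip, Equiv.coe_fn_mk]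
    omega
  · intro q e z
    simp only [halfSegment, flip, Equiv.coe_fn_mk, Set.mem_ofPred_eq, Prod.ext_iff, ne_eq]
    omega

theorem isGridSymmetry_rotate (a b : ℤ) : IsGridSymmetry (rotate a b) := by
  constructor
  · intro p q
    simp only [Aligned, rotate, Equiv.coe_fn_mk]
    omega
  · intro q e z
    simp only [halfSegment, rotate, Equiv.coe_fn_mk, Set.mem_ofPred_eq, Prod.ext_iff, ne_eq]
    omega

theorem isGridSymmetry_prodComm : IsGridSymmetry (Equiv.prodComm ℤ ℤ) := by
  constructor
  · intro p q
    simp only [Aligned, Equiv.prodComm_apply, Prod.fst_swap, Prod.snd_swap]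
    omega
  · intro q e z
    simp only [halfSegment, Equiv.prodComm_apply, Prod.fst_swap, Prod.snd_swap, Set.mem_ofPred_eq,
      Prod.ext_iff, ne_eq]
    omega

/-! ### Paths with hanging trees -/

/-- The tree that consists of a path, with the trees of the list `ls` hanging from its vertices,
and of `t` hanging from the end of the path. -/
def plug (ls : List (BinaryTree Unit)) (t : BinaryTree Unit) : BinaryTree Unit :=
  ls.foldr (.node ()) t

/-- The path with the hanging trees `ls` can be drawn within `R`, from `e` to `q`, in such a way
that any drawing of a tree hanging from `q` outside `R` extends it. -/
def PathDrawn (ls : List (BinaryTree Unit)) (e q : ℤ × ℤ) (R : Set (ℤ × ℤ)) : Prop :=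
  ∀ t R', Disjoint R R' → Hangs t q R' → Drawn (plug ls t) e (R ∪ R')

theorem PathDrawn.mono {ls : List (BinaryTree Unit)} {e q : ℤ × ℤ} {R S : Set (ℤ × ℤ)}
    (h : PathDrawn ls e q R) (hR : R ⊆ S) : PathDrawn ls e q S := fun t R' hd ht =>
  (h t R' (hd.mono_left hR) ht).mono (Set.union_subset_union_left _ hR)

theorem PathDrawn.map {σ : ℤ × ℤ ≃ ℤ × ℤ} (hσ : IsGridSymmetry σ)
    {ls : List (BinaryTree Unit)} {e q : ℤ × ℤ} {R : Set (ℤ × ℤ)} (h : PathDrawn ls e q R) :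
    PathDrawn ls (σ e) (σ q) (σ.symm ⁻¹' R) := by
  intro t R' hd ht
  have h1 := ht.map hσ.symm
  have h2 := (h t (σ ⁻¹' R') (by simpa [Set.preimage_preimage] using hd.preimage σ)
    (by simpa using h1)).map hσ
  simpa [Set.preimage_preimage] using h2

theorem pathDrawn_singleton {t : BinaryTree Unit} {e : ℤ × ℤ} {A R : Set (ℤ × ℤ)}
    (h : Hangs t e A) (he : e ∈ R) (heA : e ∉ A) (hA : A ⊆ R) : PathDrawn [t] e e R := by
  intro s R' hd hs
  exact ⟨.inl he, A, R', hA.trans Set.subset_union_left, Set.subset_union_right, heA,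
    Set.disjoint_left.1 hd he, hd.mono_left hA, h, hs⟩

/-- The second path, together with whatever hangs from its end, is itself a tree hanging from the
end `q` of the first path, through the edge from `e'` to `q`. -/
theorem PathDrawn.append {ls ls' : List (BinaryTree Unit)} {e q e' q' : ℤ × ℤ}
    {R R' S : Set (ℤ × ℤ)} (h : PathDrawn ls e q R) (h' : PathDrawn ls' e' q' R')
    (ha : Aligned e' q) (hR : R ⊆ S) (hR' : R' ⊆ S) (hS : halfSegment e' q ⊆ S)
    (hd : Disjoint R R') (hdR : ∀ z ∈ halfSegment e' q, z ∉ R)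
    (hdR' : ∀ z ∈ halfSegment e' q, z ∈ R' → z = e') : PathDrawn (ls ++ ls') e q' S := by
  intro t A hA ht
  have h2 := h' t A (hA.mono_left hR') ht
  have h3 : Hangs (plug ls' t) q (R' ∪ A ∪ halfSegment e' q) := by
    refine .inr ⟨e', _, ha, h2, Set.subset_union_left, Set.subset_union_right, ?_⟩
    rintro z hz (hz' | hz')
    · exact hdR' z hz hz'
    · exact absurd hz' (Set.disjoint_left.1 hA (hS hz))
  have h4 := h _ (R' ∪ A ∪ halfSegment e' q) (by
    rw [Set.disjoint_left] at hd hA ⊢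
    rintro z hz ((h | h) | h)
    · exact hd hz h
    · exact hA (hR hz) h
    · exact hdR z h hz) h3
  rw [plug, List.foldr_append]
  refine Drawn.mono h4 ?_
  rintro z (h | (h | h) | h)
  · exact .inl (hR h)
  · exact .inl (hR' h)
  · exact .inr h
  · exact .inl (hS h)

/-! ### Drawings in boxes -/

/-- The grid points of a box with a corner at the origin. -/
def box (w h : ℕ) : Set (ℤ × ℤ) := {z | 0 ≤ z.1 ∧ z.1 < w ∧ 0 ≤ z.2 ∧ z.2 < h}

/-- The tree has a drawing in the box with its root at the origin. -/
def TreeInBox (t : BinaryTree Unit) (w h : ℕ) : Prop := Drawn t (0, 0) (box w h)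

/-- The path with hanging trees has a drawing in the box from one corner to the opposite one. -/
def DiagonalInBox (ls : List (BinaryTree Unit)) (w h : ℕ) : Prop :=
  PathDrawn ls (0, 0) (w - 1, h - 1) (box w h)

/-- The path with hanging trees, if it is not empty, has a drawing in the box from the origin to
a point in the same row, the rest of which is free. -/
def RowInBox (ls : List (BinaryTree Unit)) (w h : ℕ) : Prop :=
  ls = [] ∨ ∃ x : ℤ, 0 ≤ x ∧ x < w ∧
    PathDrawn ls (0, 0) (x, 0) {z | z ∈ box w h ∧ (z.2 = 0 → z.1 ≤ x)}

theorem box_mono {w w' h h' : ℕ} (hw : w ≤ w') (hh : h ≤ h') : box w h ⊆ box w' h' := by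
  rintro ⟨x, y⟩
  simp only [box, Set.mem_ofPred_eq]
  omega

theorem TreeInBox.mono {t : BinaryTree Unit} {w w' h h' : ℕ} (H : TreeInBox t w h)
    (hw : w ≤ w') (hh : h ≤ h') : TreeInBox t w' h' := Drawn.mono H (box_mono hw hh)

theorem RowInBox.mono {ls : List (BinaryTree Unit)} {w w' h h' : ℕ} (H : RowInBox ls w h)
    (hw : w ≤ w') (hh : h ≤ h') : RowInBox ls w' h' := by
  rcases H with H | ⟨x, h0, h1, H⟩
  · exact .inl H
  · exact .inr ⟨x, h0, by omega, H.mono fun z hz => ⟨box_mono hw hh hz.1, hz.2⟩⟩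

theorem TreeInBox.transpose {t : BinaryTree Unit} {w h : ℕ} (H : TreeInBox t w h) :
    TreeInBox t h w := by
  refine (Drawn.map isGridSymmetry_prodComm H).mono ?_
  rintro ⟨x, y⟩
  simp only [box, Set.mem_preimage, Equiv.prodComm_symm, Equiv.prodComm_apply, Prod.swap_prod_mk,
    Set.mem_ofPred_eq]
  omega

theorem DiagonalInBox.transpose {ls : List (BinaryTree Unit)} {w h : ℕ}
    (H : DiagonalInBox ls w h) : DiagonalInBox ls h w := by
  refine (PathDrawn.map isGridSymmetry_prodComm H).mono ?_
  rintro ⟨x, y⟩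
  simp only [box, Set.mem_preimage, Equiv.prodComm_symm, Equiv.prodComm_apply, Prod.swap_prod_mk,
    Set.mem_ofPred_eq]
  omega

/-- Shift the drawing down by one row and put the path vertex directly above its root. -/
theorem TreeInBox.rowInBox_singleton {t : BinaryTree Unit} {w h : ℕ} (H : TreeInBox t w h)
    (hw : 1 ≤ w) : RowInBox [t] w (h + 1) := by
  refine .inr ⟨0, le_rfl, by omega, pathDrawn_singleton
    (A := {z | z ∈ box w (h + 1) ∧ 1 ≤ z.2}) ?_ ?_ ?_ ?_⟩
  · cases t with
    | nil => exact .inl rfl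
    | node a l r =>
      have h0 : (0, 0) ∈ box w h := H.1
      refine .inr ⟨_, _, ?_, Drawn.map (isGridSymmetry_translate 0 1) H, ?_, ?_, ?_⟩
      · simp [Aligned, translate]
      · rintro ⟨x, y⟩
        simp only [box, translate, Equiv.coe_fn_symm_mk, Set.mem_preimage, Set.mem_ofPred_eq]
        push_cast
        omega
      · rintro ⟨x, y⟩
        simp only [box, halfSegment, translate, Equiv.coe_fn_mk, Set.mem_ofPred_eq,
          Prod.ext_iff, ne_eq] at h0 ⊢
        push_cast
        omega
      · rintro ⟨x, y⟩
        simp only [halfSegment, translate, Equiv.coe_fn_mk, Set.mem_ofPred_eq,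
          Prod.ext_iff, ne_eq]
        omega
  · simp [box]
    omega
  · simp
  · rintro ⟨x, y⟩
    simp only [box, Set.mem_ofPred_eq]
    omega

theorem RowInBox.append {ls ls' : List (BinaryTree Unit)} {w w' h : ℕ} (hh : 1 ≤ h)
    (H : RowInBox ls w h) (H' : RowInBox ls' w' h) : RowInBox (ls ++ ls') (w + w') h := by
  rcases H' with rfl | ⟨x', h0', h1', H'⟩
  · rw [List.append_nil]
    exact H.mono (by omega) le_rfl
  rcases H with rfl | ⟨x, h0, h1, H⟩
  · exact (show RowInBox ls' w' h from .inr ⟨x', h0', h1', H'⟩).mono (by omega) le_rfl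
  refine .inr ⟨x' + w, by omega, by push_cast; omega, ?_⟩
  have h2 := H'.map (isGridSymmetry_translate w 0)
  simp only [translate, Equiv.coe_fn_mk, Equiv.coe_fn_symm_mk, Set.preimage_ofPred_eq, zero_add,
    box, Set.mem_ofPred_eq] at h2
  refine H.append h2 ?_ ?_ ?_ ?_ ?_ ?_ ?_
  · simp [Aligned]
  · rintro ⟨a, b⟩
    simp only [box, Set.mem_ofPred_eq]
    push_cast
    omega
  · rintro ⟨a, b⟩
    simp only [box, Set.mem_ofPred_eq]
    push_cast
    omega
  · rintro ⟨a, b⟩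
    simp only [box, halfSegment, Set.mem_ofPred_eq, Prod.ext_iff, ne_eq]
    push_cast
    omega
  · rw [Set.disjoint_left]
    rintro ⟨a, b⟩
    simp only [box, Set.mem_ofPred_eq]
    omega
  · rintro ⟨a, b⟩
    simp only [box, halfSegment, Set.mem_ofPred_eq, Prod.ext_iff, ne_eq]
    omega
  · rintro ⟨a, b⟩
    simp only [halfSegment, Set.mem_ofPred_eq, Prod.ext_iff, ne_eq]
    omega

/-- The first path descends to the bottom right corner of its box. The second one, reflected
vertically, starts next to that corner in the bottom row and climbs back to the top row. -/
theorem DiagonalInBox.append {ls ls' : List (BinaryTree Unit)} {w w' h : ℕ} (hw : 1 ≤ w)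
    (hw' : 1 ≤ w') (hh : 1 ≤ h) (H : DiagonalInBox ls w h) (H' : DiagonalInBox ls' w' h) :
    RowInBox (ls ++ ls') (w + w') h := by
  refine .inr ⟨w' - 1 + w, by omega, by push_cast; omega, ?_⟩
  have h2 := PathDrawn.map (isGridSymmetry_flip w (h - 1)) H'
  simp only [flip, Equiv.coe_fn_mk, Equiv.coe_fn_symm_mk, zero_add, sub_zero, sub_self] at h2
  refine PathDrawn.append H h2 ?_ ?_ ?_ ?_ ?_ ?_ ?_
  · simp [Aligned]
  · rintro ⟨a, b⟩
    simp only [box, Set.mem_ofPred_eq]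
    push_cast
    omega
  · rintro ⟨a, b⟩
    simp only [box, Set.mem_ofPred_eq, Set.mem_preimage]
    push_cast
    omega
  · rintro ⟨a, b⟩
    simp only [box, halfSegment, Set.mem_ofPred_eq, Prod.ext_iff, ne_eq]
    push_cast
    omega
  · rw [Set.disjoint_left]
    rintro ⟨a, b⟩
    simp only [box, Set.mem_ofPred_eq, Set.mem_preimage]
    omega
  · rintro ⟨a, b⟩
    simp only [box, halfSegment, Set.mem_ofPred_eq, Prod.ext_iff, ne_eq]
    omega
  · rintro ⟨a, b⟩
    simp only [box, halfSegment, Set.mem_ofPred_eq, Set.mem_preimage, Prod.ext_iff, ne_eq]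
    omega

theorem RowInBox.treeInBox {ls : List (BinaryTree Unit)} {w h : ℕ} (H : RowInBox ls w h) :
    TreeInBox (plug ls .nil) w h := by
  rcases H with rfl | ⟨x, -, -, H⟩
  · trivial
  · refine (H .nil ∅ (by simp) (.inl rfl)).mono ?_
    rintro z (hz | hz)
    · exact hz.1
    · exact hz.elim

/-- A path drawn in a row, followed by three vertices that lead down to the opposite corner. -/
theorem RowInBox.diagonalInBox {ls : List (BinaryTree Unit)} {t₁ t₂ t₃ : BinaryTree Unit}
    {w w₁ w₂ w₃ W h : ℕ} (hls : ls ≠ []) (hh : 1 ≤ h) (H : RowInBox ls w (h + 1))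
    (H₁ : TreeInBox t₁ w₁ h) (H₂ : TreeInBox t₂ w₂ h) (H₃ : TreeInBox t₃ w₃ h)
    (hW : w + w₁ + w₂ + w₃ + 2 ≤ W) : DiagonalInBox (ls ++ [t₁, t₂, t₃]) W (h + 1) := by
  obtain ⟨x, h0, h1, H⟩ := H.resolve_left hls
  -- Each of the three last trees is placed with its root next to its path vertex, so the half-open
  -- edge is the root alone. The path runs along the top row to column `Y`, drops to the bottom row
  -- and continues to the last column. `t₁` lies right of column `Y` and above the bottom row, `t₂`
  -- left of it and below the top row, and `t₃` above the final corner.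
  have Hang : ∀ {t : BinaryTree Unit} {v k : ℕ} (σ : ℤ × ℤ ≃ ℤ × ℤ) (e : ℤ × ℤ),
      IsGridSymmetry σ → TreeInBox t v k → Aligned (σ (0, 0)) e →
      (∀ z ∈ halfSegment (σ (0, 0)) e, z = σ (0, 0)) →
      Hangs t e {z | σ.symm z ∈ box v k} := by
    intro t v k σ e hσ ht ha hs
    cases t with
    | nil => exact .inl rfl
    | node a l r =>
      have h0 : (0, 0) ∈ box v k := ht.1
      refine .inr ⟨_, _, ha, Drawn.map hσ ht, fun _ h => h, fun z hz => ?_, fun z hz _ => hs z hz⟩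
      rw [hs z hz]
      simpa using h0
  -- the column of the first two of the three vertices
  set Y : ℤ := w + w₂ with hY
  have P₁ : PathDrawn [t₁] (Y, 0) (Y, 0)
      {z | z = (Y, 0) ∨ (z.1 - (Y + 1), z.2 - 0) ∈ box w₁ h} := by
    refine pathDrawn_singleton (Hang (translate (Y + 1) 0) (Y, 0) (isGridSymmetry_translate _ _)
      H₁ ?_ ?_) (.inl rfl) ?_ fun z hz => .inr hz
    · simp [Aligned, translate]
    · rintro ⟨a, b⟩
      simp only [halfSegment, translate, Equiv.coe_fn_mk, Set.mem_ofPred_eq, Prod.ext_iff, ne_eq]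
      omega
    · simp [translate, box]
  have P₂ : PathDrawn [t₂] (Y, h) (Y, h)
      {z | z = (Y, (h : ℤ)) ∨ (Y - 1 - z.1, h - z.2) ∈ box w₂ h} := by
    refine pathDrawn_singleton (Hang (rotate (Y - 1) h) (Y, h) (isGridSymmetry_rotate _ _)
      H₂ ?_ ?_) (.inl rfl) ?_ fun z hz => .inr hz
    · simp [Aligned, rotate]
    · rintro ⟨a, b⟩
      simp only [halfSegment, rotate, Equiv.coe_fn_mk, Set.mem_ofPred_eq, Prod.ext_iff, ne_eq]
      omega
    · simp [rotate, box]
  have P₃ : PathDrawn [t₃] (W - 1, h) (W - 1, h)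
      {z | z = ((W : ℤ) - 1, (h : ℤ)) ∨ (W - 1 - z.1, h - 1 - z.2) ∈ box w₃ h} := by
    refine pathDrawn_singleton (Hang (rotate (W - 1) (h - 1)) (W - 1, h)
      (isGridSymmetry_rotate _ _) H₃ ?_ ?_) (.inl rfl) ?_ fun z hz => .inr hz
    · simp [Aligned, rotate]
    · rintro ⟨a, b⟩
      simp only [halfSegment, rotate, Equiv.coe_fn_mk, Set.mem_ofPred_eq, Prod.ext_iff, ne_eq]
      omega
    · simp [rotate, box]
  have Q₁ : PathDrawn (ls ++ [t₁]) (0, 0) (Y, 0) {z | z ∈ box W (h + 1) ∧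
      (z.1 < w ∨ (z.1 ≤ Y ∧ z.2 = 0) ∨ (Y < z.1 ∧ z.1 < Y + 1 + w₁ ∧ z.2 < h))} := by
    refine H.append P₁ (.inr rfl) ?_ ?_ ?_ ?_ ?_ ?_
    · rintro ⟨a, b⟩
      simp only [box, Set.mem_ofPred_eq]
      omega
    · rintro ⟨a, b⟩
      simp only [box, Set.mem_ofPred_eq, Prod.ext_iff]
      push_cast
      omega
    · rintro ⟨a, b⟩
      simp only [box, halfSegment, Set.mem_ofPred_eq, Prod.ext_iff, ne_eq]
      push_cast
      omega
    · rw [Set.disjoint_left]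
      rintro ⟨a, b⟩
      simp only [box, Set.mem_ofPred_eq, Prod.ext_iff]
      omega
    · rintro ⟨a, b⟩
      simp only [box, halfSegment, Set.mem_ofPred_eq, Prod.ext_iff, ne_eq]
      omega
    · rintro ⟨a, b⟩
      simp only [box, halfSegment, Set.mem_ofPred_eq, Prod.ext_iff, ne_eq]
      omega
  have Q₂ : PathDrawn (ls ++ [t₁] ++ [t₂]) (0, 0) (Y, h) {z | z ∈ box W (h + 1) ∧
      (z.1 ≤ Y ∨ (Y < z.1 ∧ z.1 < Y + 1 + w₁ ∧ z.2 < h))} := by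
    refine Q₁.append P₂ (.inl rfl) ?_ ?_ ?_ ?_ ?_ ?_
    · rintro ⟨a, b⟩
      simp only [box, Set.mem_ofPred_eq]
      omega
    · rintro ⟨a, b⟩
      simp only [box, Set.mem_ofPred_eq, Prod.ext_iff]
      push_cast
      omega
    · rintro ⟨a, b⟩
      simp only [box, halfSegment, Set.mem_ofPred_eq, Prod.ext_iff, ne_eq]
      push_cast
      omega
    · rw [Set.disjoint_left]
      rintro ⟨a, b⟩
      simp only [box, Set.mem_ofPred_eq, Prod.ext_iff]
      omega
    · rintro ⟨a, b⟩
      simp only [box, halfSegment, Set.mem_ofPred_eq, Prod.ext_iff, ne_eq]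
      omega
    · rintro ⟨a, b⟩
      simp only [box, halfSegment, Set.mem_ofPred_eq, Prod.ext_iff, ne_eq]
      omega
  have Q₃ : PathDrawn (ls ++ [t₁] ++ [t₂] ++ [t₃]) (0, 0) (W - 1, h) (box W (h + 1)) := by
    refine Q₂.append P₃ (.inr rfl) ?_ ?_ ?_ ?_ ?_ ?_
    · rintro ⟨a, b⟩
      simp only [box, Set.mem_ofPred_eq]
      omega
    · rintro ⟨a, b⟩
      simp only [box, Set.mem_ofPred_eq, Prod.ext_iff]
      push_cast
      omega
    · rintro ⟨a, b⟩
      simp only [box, halfSegment, Set.mem_ofPred_eq, Prod.ext_iff, ne_eq]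
      push_cast
      omega
    · rw [Set.disjoint_left]
      rintro ⟨a, b⟩
      simp only [box, Set.mem_ofPred_eq, Prod.ext_iff]
      omega
    · rintro ⟨a, b⟩
      simp only [box, halfSegment, Set.mem_ofPred_eq, Prod.ext_iff, ne_eq]
      omega
    · rintro ⟨a, b⟩
      simp only [box, halfSegment, Set.mem_ofPred_eq, Prod.ext_iff, ne_eq]
      omega
  simpa [DiagonalInBox] using Q₃

/-! ### The spine of a tree -/

/-- The subtrees that hang from the path which always descends to a largest subtree. -/
def spine : BinaryTree Unit → List (BinaryTree Unit)
  | .nil => []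
  | .node _ l r => if l.numNodes ≤ r.numNodes then l :: spine r else r :: spine l

/-- Children may be swapped in a drawing, so each chosen larger child may be taken to be the right
one. -/
theorem Drawn.of_spine {t : BinaryTree Unit} : ∀ {e : ℤ × ℤ} {R : Set (ℤ × ℤ)},
    Drawn (plug (spine t) .nil) e R → Drawn t e R := by
  have hang : ∀ t : BinaryTree Unit, (∀ {e : ℤ × ℤ} {R : Set (ℤ × ℤ)},
      Drawn (plug (spine t) .nil) e R → Drawn t e R) → ∀ {e : ℤ × ℤ} {A : Set (ℤ × ℤ)},
      Hangs (plug (spine t) .nil) e A → Hangs t e A := by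
    rintro t ih e A (h | ⟨q, A', h1, h2, h3⟩)
    · cases t with
      | nil => exact .inl rfl
      | node a l r =>
        rw [spine] at h
        split_ifs at h <;> simp [plug] at h
    · exact .inr ⟨q, A', h1, ih h2, h3⟩
  induction t with
  | nil => exact fun _ => trivial
  | node a l r ihl ihr =>
    intro e R h
    rw [spine] at h
    split_ifs at h with hlr
    · obtain ⟨he, A, B, hA, hB, heA, heB, hd, hl, hr⟩ := h
      exact ⟨he, A, B, hA, hB, heA, heB, hd, hl, hang r ihr hr⟩
    · obtain ⟨he, A, B, hA, hB, heA, heB, hd, hl, hr⟩ := h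
      exact Drawn.swap_children (l := r) (r := l)
        ⟨he, A, B, hA, hB, heA, heB, hd, hl, hang l ihl hr⟩

theorem two_mul_numNodes_lt_of_mem_spine {t s : BinaryTree Unit} (h : s ∈ spine t) :
    2 * s.numNodes < t.numNodes := by
  induction t with
  | nil => simp [spine] at h
  | node a l r ihl ihr =>
    rw [spine] at h
    split_ifs at h <;> rcases List.mem_cons.1 h with rfl | h <;>
      simp only [BinaryTree.numNodes] <;> grind

/-- The number of vertices of a path and of the trees that hang from it. -/
def pathSize (ls : List (BinaryTree Unit)) : ℕ := (ls.map fun t => t.numNodes + 1).sum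

@[simp] theorem pathSize_nil : pathSize [] = 0 := rfl

@[simp] theorem pathSize_cons (t : BinaryTree Unit) (ls : List (BinaryTree Unit)) :
    pathSize (t :: ls) = t.numNodes + 1 + pathSize ls := by simp [pathSize]

@[simp] theorem pathSize_append (ls ls' : List (BinaryTree Unit)) :
    pathSize (ls ++ ls') = pathSize ls + pathSize ls' := by simp [pathSize]

/-- The bound for the width of a path, up to a factor `b` and an additive term, where the trees
with fewer than `b` nodes fit into boxes of width `S`. -/
def cost (b S : ℕ) (ls : List (BinaryTree Unit)) : ℕ :=
  (ls.map fun t => if t.numNodes < b then 7 * S * (t.numNodes + 1) else 28 * S * t.numNodes).sum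

@[simp] theorem cost_nil (b S : ℕ) : cost b S [] = 0 := rfl

@[simp] theorem cost_cons (b S : ℕ) (t : BinaryTree Unit) (ls : List (BinaryTree Unit)) :
    cost b S (t :: ls) = (if t.numNodes < b then 7 * S * (t.numNodes + 1)
      else 28 * S * t.numNodes) + cost b S ls := by simp [cost]

theorem cost_le (b S : ℕ) (ls : List (BinaryTree Unit)) :
    cost b S ls ≤ 28 * S * pathSize ls := by
  induction ls with
  | nil => simp
  | cons t ls ih =>
    rw [cost_cons, pathSize_cons]
    split_ifs <;> nlinarith

theorem cost_spine_of_lt {b S : ℕ} {t : BinaryTree Unit} (h : t.numNodes < b) :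
    cost b S (spine t) = 7 * S * t.numNodes := by
  induction t with
  | nil => simp [spine]
  | node a l r ihl ihr =>
    simp only [BinaryTree.numNodes] at h
    rw [spine]
    split_ifs with hlr
    · rw [cost_cons, ihr (by omega), if_pos (by omega), BinaryTree.numNodes]; ring
    · rw [cost_cons, ihl (by omega), if_pos (by omega), BinaryTree.numNodes]; ring

/-- The slack comes from the lower end of the spine: the last spine subtree with at least `b` nodes
is charged only `7 * S` per node instead of `28 * S`, which saves at least `21 * S * b`. It pays for
two groups: the unfinished one at the end of this spine and the one that is cut off when this tree
hangs from another spine. -/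
theorem cost_spine_add_le {b S : ℕ} {t : BinaryTree Unit} (h : b ≤ t.numNodes) :
    cost b S (spine t) + 14 * S * b ≤ 28 * S * t.numNodes := by
  have key : ∀ l r : BinaryTree Unit, l.numNodes ≤ r.numNodes →
      b ≤ l.numNodes + r.numNodes + 1 →
      (b ≤ r.numNodes → cost b S (spine r) + 14 * S * b ≤ 28 * S * r.numNodes) →
      cost b S (l :: spine r) + 14 * S * b ≤ 28 * S * (l.numNodes + r.numNodes + 1) := by
    intro l r hlr hb ih
    rw [cost_cons]
    rcases le_or_gt b r.numNodes with hr | hr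
    · have := ih hr
      split_ifs <;> nlinarith
    · rw [cost_spine_of_lt hr, if_pos (by omega)]
      have := Nat.mul_le_mul_left (14 * S) hb
      nlinarith
  induction t with
  | nil => simp at h; simp [h, spine]
  | node a l r ihl ihr =>
    simp only [BinaryTree.numNodes] at h ⊢
    rw [spine]
    split_ifs with hlr
    · exact key l r hlr h ihr
    · rw [add_comm l.numNodes]
      exact key r l (by omega) (by omega) ihl

/-- Trees with fewer than `2 * b` nodes have drawings in boxes of size `S × L`, also those that
consist of a path, to be drawn from corner to corner, and of trees hanging from it. -/
structure Fits (b S L : ℕ) : Prop where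
  one_le_size : 1 ≤ b
  one_le_width : 1 ≤ S
  one_le_height : 1 ≤ L
  tree : ∀ t : BinaryTree Unit, t.numNodes < 2 * b → TreeInBox t S L
  path : ∀ ls : List (BinaryTree Unit), 4 ≤ ls.length → pathSize ls < 2 * b → DiagonalInBox ls S L

theorem fits_one : Fits 1 1 1 where
  one_le_size := le_rfl
  one_le_width := le_rfl
  one_le_height := le_rfl
  tree t ht := by
    cases t with
    | nil => trivial
    | node a l r =>
      simp only [BinaryTree.numNodes] at ht
      have hl : l = .nil := by cases l with
        | nil => rfl
        | node => simp only [BinaryTree.numNodes] at ht; omega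
      have hr : r = .nil := by cases r with
        | nil => rfl
        | node => simp only [BinaryTree.numNodes] at ht; omega
      exact ⟨by simp [box], ∅, ∅, by simp, by simp, by simp, by simp, by simp, .inl hl, .inl hr⟩
  path ls h4 hls := by
    match ls, h4 with
    -- Vacuous: two path vertices already have total size at least `2`.
    | _ :: _ :: _, _ => simp only [pathSize_cons] at hls; omega

/-! ### One round: packing hanging trees into boxes -/

variable {b S L : ℕ}

theorem rowInBox_of_forall_treeInBox {ls : List (BinaryTree Unit)} {w h : ℕ} (hw : 1 ≤ w)
    (H : ∀ t ∈ ls, TreeInBox t w h) : RowInBox ls (ls.length * w) (h + 1) := by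
  induction ls with
  | nil => exact .inl rfl
  | cons t ls ih =>
    have h1 := ((H t (by simp)).rowInBox_singleton hw).append (by omega)
      (ih fun s hs => H s (by simp [hs]))
    refine RowInBox.mono h1 (by rw [List.length_cons]; linarith) le_rfl

theorem numNodes_lt_pathSize {t : BinaryTree Unit} {ls : List (BinaryTree Unit)} (h : t ∈ ls) :
    t.numNodes < pathSize ls := by
  induction ls with
  | nil => simp at h
  | cons s ls ih =>
    rw [pathSize_cons]
    rcases List.mem_cons.1 h with rfl | h
    · omega
    · have := ih h; omega

/-- At least eight trees split into two paths with at least four each, drawn down and up in width `2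
* S`. At most seven trees are placed side by side, whence the factor `7`. -/
theorem Fits.rowInBox (H : Fits b S L) {ls : List (BinaryTree Unit)} (hls : pathSize ls < 2 * b) :
    RowInBox ls (7 * S) (L + 1) := by
  have hS := H.one_le_width
  rcases le_or_gt 8 ls.length with h8 | h8
  · have hsplit := List.take_append_drop 4 ls
    have hsize := congrArg pathSize hsplit
    rw [pathSize_append] at hsize
    have h1 := H.path (ls.take 4) (by rw [List.length_take]; omega) (by omega)
    have h2 := H.path (ls.drop 4) (by rw [List.length_drop]; omega) (by omega)
    have h3 := h1.append hS hS H.one_le_height h2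
    rw [hsplit] at h3
    exact h3.mono (by omega) (by omega)
  · refine (rowInBox_of_forall_treeInBox hS fun t ht => H.tree t ?_).mono
      (Nat.mul_le_mul_right _ (by omega)) le_rfl
    exact (numNodes_lt_pathSize ht).trans hls

/-- Consecutive small trees are grouped, up to a total size of less than `2 * b`, and each group is
drawn in a box of its own. -/
theorem Fits.exists_rowInBox (H : Fits b S L) {h : ℕ} (hh : L ≤ h)
    (ls : List (BinaryTree Unit)) (hls : ∀ t ∈ ls, b ≤ t.numNodes →
      ∃ w, 1 ≤ w ∧ b * w + 7 * S * b ≤ 28 * S * t.numNodes ∧ TreeInBox t w h) :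
    ∃ w, b * w ≤ cost b S ls + 7 * S * b ∧ RowInBox ls w (h + 1) := by
  -- `acc` is the open group. Adding a small tree keeps it below `2 * b`; once it reaches `b`, its
  -- own size pays for its `7 * S` columns. A large tree closes the group early and pays for it with
  -- the extra `7 * S * b` in its hypothesis.
  suffices key : ∀ acc, pathSize acc < b → ∃ w,
      b * w ≤ 7 * S * pathSize acc + cost b S ls + 7 * S * b ∧ RowInBox (acc ++ ls) w (h + 1) by
    simpa using key [] (by simpa using Nat.succ_le_iff.1 H.one_le_size)
  induction ls with
  | nil =>
    intro acc hacc
    refine ⟨7 * S, by nlinarith, ?_⟩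
    rw [List.append_nil]
    exact (H.rowInBox (by omega)).mono le_rfl (by omega)
  | cons t ls ih =>
    intro acc hacc
    have ih := ih fun s hs => hls s (by simp [hs])
    rcases lt_or_ge t.numNodes b with ht | ht
    · rcases lt_or_ge (pathSize (acc ++ [t])) b with hs | hs
      · obtain ⟨w, hw, hrow⟩ := ih _ hs
        refine ⟨w, ?_, by simpa using hrow⟩
        rw [cost_cons, if_pos ht]
        simp only [pathSize_append, pathSize_cons, pathSize_nil] at hw
        linarith
      · obtain ⟨w, hw, hrow⟩ := ih [] (by simpa using Nat.succ_le_iff.1 H.one_le_size)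
        have h1 : RowInBox (acc ++ [t]) (7 * S) (h + 1) :=
          (H.rowInBox (by simp; omega)).mono le_rfl (by omega)
        refine ⟨7 * S + w, ?_, by simpa using h1.append (by omega) hrow⟩
        rw [cost_cons, if_pos ht]
        have h2 := Nat.mul_le_mul_left (7 * S) hs
        simp only [pathSize_append, pathSize_cons, pathSize_nil] at hw h2
        linarith
    · obtain ⟨w, hw, hrow⟩ := ih [] (by simpa using Nat.succ_le_iff.1 H.one_le_size)
      obtain ⟨v, hv, hvt, htree⟩ := hls t (by simp) ht
      have h1 : RowInBox acc (7 * S) (h + 1) := (H.rowInBox (by omega)).mono le_rfl (by omega)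
      refine ⟨7 * S + (v + w), ?_, by
        simpa using h1.append (by omega) ((htree.rowInBox_singleton hv).append (by omega) hrow)⟩
      rw [cost_cons, if_neg (by omega)]
      simp only [pathSize_nil] at hw
      nlinarith

/-- Trees hanging from the spine have fewer than half of the nodes, so they satisfy the claim for `j
- 1` if they are large. The spine adds one row. -/
theorem Fits.exists_treeInBox_of_le (H : Fits b S L) (j : ℕ) :
    ∀ t : BinaryTree Unit, t.numNodes < 2 ^ j → b ≤ t.numNodes →
      ∃ w, 1 ≤ w ∧ b * w + 7 * S * b ≤ 28 * S * t.numNodes ∧ TreeInBox t w (L + j) := by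
  have hb := H.one_le_size
  induction j with
  | zero => intro t ht; simp at ht; omega
  | succ j ih =>
    intro t ht hbt
    obtain ⟨w, hw, hrow⟩ := H.exists_rowInBox (Nat.le_add_right L j) (spine t) fun s hs =>
      ih s (by have := two_mul_numNodes_lt_of_mem_spine hs; rw [pow_succ] at ht; omega)
    have htree : TreeInBox t w (L + (j + 1)) := Drawn.of_spine hrow.treeInBox
    refine ⟨w, ?_, ?_, htree⟩
    · cases t with
      | nil => simp at hbt; omega
      | node a l r =>
        have := htree.1
        simp only [box, Set.mem_ofPred_eq] at this
        omega
    · have := cost_spine_add_le (S := S) hbt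
      linarith

theorem Fits.exists_treeInBox (H : Fits b S L) {j : ℕ} {t : BinaryTree Unit}
    (ht : t.numNodes < 2 ^ j) :
    ∃ w, b * w ≤ 28 * S * t.numNodes + S * b ∧ TreeInBox t w (L + j) := by
  rcases lt_or_ge t.numNodes b with h | h
  · exact ⟨S, by nlinarith, (H.tree t (by omega)).mono le_rfl (by omega)⟩
  · obtain ⟨w, -, hw, htree⟩ := H.exists_treeInBox_of_le j t ht h
    exact ⟨w, by linarith [Nat.zero_le (S * b)], htree⟩

theorem Fits.diagonalInBox (H : Fits b S L) {j W : ℕ} {ls : List (BinaryTree Unit)}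
    (h4 : 4 ≤ ls.length) (hls : pathSize ls < 2 ^ j)
    (hW : 28 * S * pathSize ls + 12 * S * b ≤ b * W) : DiagonalInBox ls W (L + j + 1) := by
  have hb := H.one_le_size
  have hS := H.one_le_width
  have hsplit := List.take_append_drop (ls.length - 3) ls
  have hdrop : (ls.drop (ls.length - 3)).length = 3 := by rw [List.length_drop]; omega
  have htake : ls.take (ls.length - 3) ≠ [] := by
    rw [← List.length_pos_iff, List.length_take]; omega
  obtain ⟨t₁, t₂, t₃, h3⟩ := List.length_eq_three.1 hdrop
  rw [h3] at hsplit
  generalize ls.take (ls.length - 3) = ls₀ at hsplit htake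
  subst hsplit
  have hlt : ∀ t ∈ ls₀ ++ [t₁, t₂, t₃], t.numNodes < 2 ^ j := fun t ht =>
    (numNodes_lt_pathSize ht).trans hls
  obtain ⟨w, hw, hrow⟩ := H.exists_rowInBox (Nat.le_add_right L j) ls₀ fun t ht =>
    H.exists_treeInBox_of_le j t (hlt t (by simp [ht]))
  obtain ⟨w₁, hw₁, H₁⟩ := H.exists_treeInBox (hlt t₁ (by simp))
  obtain ⟨w₂, hw₂, H₂⟩ := H.exists_treeInBox (hlt t₂ (by simp))
  obtain ⟨w₃, hw₃, H₃⟩ := H.exists_treeInBox (hlt t₃ (by simp))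
  refine hrow.diagonalInBox htake (by have := H.one_le_height; omega) H₁ H₂ H₃ ?_
  have hc := cost_le b S ls₀
  have hSb := Nat.mul_le_mul_right b hS
  simp only [pathSize_append, pathSize_cons, pathSize_nil] at hW
  refine Nat.le_of_mul_le_mul_left ?_ hb
  -- The `12 * S * b` consists of `7 * S * b` for the last group, `S * b` for each of the three
  -- final trees, and `2 * b ≤ 2 * S * b` for the two extra columns.
  nlinarith

/-- With `j = 2 * L` the heights are at most `3 * L + 1`, and `40 = 28 + 12` covers the widths.
Transposing makes the short side the new width, so that the next round again adds its logarithmic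
number of rows to the long side. -/
theorem Fits.next {β : ℕ} (H : Fits (2 ^ β) S L) (hβ : β ≤ L) :
    Fits (2 ^ (2 * L - 1)) (3 * L + 1) (40 * S * 2 ^ (2 * L - β)) := by
  have hL := H.one_le_height
  have hS := H.one_le_width
  have hpow : 2 * 2 ^ (2 * L - 1) = 2 ^ (2 * L) := by
    rw [← pow_succ']; congr 1; omega
  have hpow' : 2 ^ β * 2 ^ (2 * L - β) = 2 ^ (2 * L) := by
    rw [← pow_add]; congr 1; omega
  have hle : 2 ^ β ≤ 2 ^ (2 * L) := Nat.pow_le_pow_right (by norm_num) (by omega)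
  have hW : 2 ^ β * (40 * S * 2 ^ (2 * L - β)) = 40 * S * 2 ^ (2 * L) := by
    rw [← hpow']; ring
  refine ⟨Nat.one_le_two_pow, by omega, Nat.one_le_iff_ne_zero.2 (by positivity),
    fun t ht => ?_, fun ls h4 hls => ?_⟩
  · rw [hpow] at ht
    obtain ⟨w, hw, htree⟩ := H.exists_treeInBox ht
    refine (htree.mono ?_ (by omega)).transpose
    refine Nat.le_of_mul_le_mul_left ?_ H.one_le_size
    rw [hW]
    have h1 := Nat.mul_le_mul_left (28 * S) ht.le
    have h2 := Nat.mul_le_mul_left S hle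
    linarith [Nat.zero_le (S * 2 ^ (2 * L))]
  · rw [hpow] at hls
    have h1 := Nat.mul_le_mul_left (28 * S) hls.le
    have h2 := Nat.mul_le_mul_left (12 * S) hle
    have h3 := H.diagonalInBox (W := 40 * S * 2 ^ (2 * L - β)) h4 hls (by rw [hW]; linarith)
    rw [show L + 2 * L + 1 = 3 * L + 1 by ring] at h3
    exact h3.transpose

/-- Iterating `Fits.next`, starting with boxes whose height is at least the `m`-fold iterated
logarithm. -/
theorem Fits.exists_treeInBox_of_iterLog_le {t : BinaryTree Unit} (m : ℕ) :
    ∀ {β S L C : ℕ}, Fits (2 ^ β) S L → β ≤ L → 2 ^ β ≤ t.numNodes → S * L ≤ C * 2 ^ β →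
      iterLog m t.numNodes ≤ L →
      ∃ W h, W * h ≤ 87 * C * 512 ^ m * t.numNodes ∧ TreeInBox t W h := by
  -- Stop once `2 * L` exceeds the logarithm of the size. The width is at most `29 * S * n / b`
  -- because `b ≤ n`, and the height is `3 * L`, hence `87 = 29 * 3`.
  have base : ∀ {β S L C : ℕ}, Fits (2 ^ β) S L → 2 ^ β ≤ t.numNodes → S * L ≤ C * 2 ^ β →
      t.numNodes < 2 ^ (2 * L) → ∃ W h, W * h ≤ 87 * C * t.numNodes ∧ TreeInBox t W h := by
    intro β S L C H hβt hC ht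
    obtain ⟨w, hw, htree⟩ := H.exists_treeInBox ht
    refine ⟨w, _, ?_, htree⟩
    have hS := Nat.mul_le_mul_left S hβt
    refine Nat.le_of_mul_le_mul_left ?_ H.one_le_size
    calc 2 ^ β * (w * (L + 2 * L)) = (2 ^ β * w) * (3 * L) := by ring
      _ ≤ (29 * S * t.numNodes) * (3 * L) := Nat.mul_le_mul_right _ (by linarith)
      _ = 87 * t.numNodes * (S * L) := by ring
      _ ≤ 87 * t.numNodes * (C * 2 ^ β) := Nat.mul_le_mul_left _ hC
      _ = 2 ^ β * (87 * C * t.numNodes) := by ring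
  induction m with
  | zero =>
    intro β S L C H hβ hβt hC hm
    simp only [iterLog, Function.iterate_zero, id, Nat.cast_le] at hm
    have h1 : L < 2 ^ L := Nat.lt_two_pow_self
    have h2 : 2 ^ L ≤ 2 ^ (2 * L) := Nat.pow_le_pow_right (by norm_num) (by omega)
    simpa using base H hβt hC (by omega)
  | succ m ih =>
    intro β S L C H hβ hβt hC hm
    have hL := H.one_le_height
    have hS := H.one_le_width
    rcases lt_or_ge t.numNodes (2 ^ (2 * L)) with ht | ht
    · obtain ⟨W, h, hWh, htree⟩ := base H hβt hC ht
      refine ⟨W, h, hWh.trans (Nat.mul_le_mul_right _ ?_), htree⟩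
      exact Nat.le_mul_of_pos_right _ (by positivity)
    · have hexp : 2 ^ L ≤ 40 * S * 2 ^ (2 * L - β) := by
        have h1 : 2 ^ L ≤ 2 ^ (2 * L - β) := Nat.pow_le_pow_right (by norm_num) (by omega)
        nlinarith [Nat.zero_le (2 ^ (2 * L - β))]
      have hlin : 2 * L - 1 ≤ 40 * S * 2 ^ (2 * L - β) := by
        have h1 : L < 2 ^ L := Nat.lt_two_pow_self
        have h2 : 2 ^ L ≤ 2 ^ (2 * L - β) := Nat.pow_le_pow_right (by norm_num) (by omega)
        have h3 := Nat.mul_le_mul_right (40 * 2 ^ (2 * L - β)) hS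
        have h4 : 2 * L - 1 ≤ 2 * L := Nat.sub_le _ _
        nlinarith
      have hpow : 2 * 2 ^ (2 * L - 1) = 2 ^ (2 * L) := by
        rw [← pow_succ']; congr 1; omega
      have hpow' : 2 ^ β * 2 ^ (2 * L - β) = 2 ^ (2 * L) := by
        rw [← pow_add]; congr 1; omega
      -- The true factor is `320`; it is rounded up to `512 = 2 ^ 9`.
      have harea : (3 * L + 1) * (40 * S * 2 ^ (2 * L - β)) ≤ C * 512 * 2 ^ (2 * L - 1) := by
        refine Nat.le_of_mul_le_mul_left ?_ H.one_le_size
        calc 2 ^ β * ((3 * L + 1) * (40 * S * 2 ^ (2 * L - β)))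
            = 40 * (3 * L + 1) * S * (2 ^ β * 2 ^ (2 * L - β)) := by ring
          _ ≤ 40 * (4 * L) * S * (2 ^ β * 2 ^ (2 * L - β)) := by gcongr; omega
          _ = 320 * (S * L) * 2 ^ (2 * L - 1) := by rw [hpow', ← hpow]; ring
          _ ≤ 320 * (C * 2 ^ β) * 2 ^ (2 * L - 1) := by gcongr
          _ ≤ 512 * (C * 2 ^ β) * 2 ^ (2 * L - 1) := by gcongr; norm_num
          _ = 2 ^ β * (C * 512 * 2 ^ (2 * L - 1)) := by ring
      have hlog : iterLog m t.numNodes ≤ (2 : ℝ) ^ L := by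
        rw [iterLog, Function.iterate_succ_apply'] at hm
        -- An iterated logarithm may be nonpositive, where `Real.logb` cannot be inverted; the bound
        -- is then trivial.
        rcases le_or_gt (iterLog m t.numNodes) 0 with h0 | h0
        · exact h0.trans (by positivity)
        · rwa [← Real.rpow_natCast, ← Real.logb_le_iff_le_rpow (by norm_num) h0]
      obtain ⟨W, h, hWh, htree⟩ := ih (H.next hβ) hlin (by omega) harea
        (hlog.trans (by exact_mod_cast hexp))
      refine ⟨W, h, hWh.trans_eq ?_, htree⟩
      ring

/-! ### From discrete to planar drawings -/

/-- The position of the parent of the node `p`, where that of the root is said to be at `e`. -/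
def parentPos (e : ℤ × ℤ) (pos : List Bool → ℤ × ℤ) (p : List Bool) : ℤ × ℤ :=
  if p = [] then e else pos p.dropLast

/-- The half-open segments from the nodes to their parents, the parent of the root being at `e`,
are horizontal or vertical, pairwise disjoint, and contained in `R`. -/
def HasDisjointEdges (t : BinaryTree Unit) (e : ℤ × ℤ) (pos : List Bool → ℤ × ℤ)
    (R : Set (ℤ × ℤ)) : Prop :=
  (∀ p, IsNode t p → Aligned (pos p) (parentPos e pos p) ∧
    halfSegment (pos p) (parentPos e pos p) ⊆ R) ∧
  ∀ p q, IsNode t p → IsNode t q → p ≠ q →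
    Disjoint (halfSegment (pos p) (parentPos e pos p)) (halfSegment (pos q) (parentPos e pos q))

theorem self_mem_halfSegment (q e : ℤ × ℤ) : q ∈ halfSegment q e := .inl rfl

theorem halfSegment_self (q : ℤ × ℤ) : halfSegment q q = {q} := by
  ext z
  simp only [halfSegment, Set.mem_ofPred_eq, Set.mem_singleton_iff, Prod.ext_iff, ne_eq]
  omega

theorem Drawn.exists_hasDisjointEdges {t : BinaryTree Unit} : ∀ {e : ℤ × ℤ} {R : Set (ℤ × ℤ)},
    Drawn t e R → ∃ pos, pos [] = e ∧ HasDisjointEdges t e pos R := by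
  have hang : ∀ t : BinaryTree Unit, (∀ {e : ℤ × ℤ} {R : Set (ℤ × ℤ)}, Drawn t e R →
      ∃ pos, pos [] = e ∧ HasDisjointEdges t e pos R) → ∀ {e : ℤ × ℤ} {A : Set (ℤ × ℤ)},
      Hangs t e A → ∃ pos, HasDisjointEdges t e pos A := by
    rintro t ih e A (rfl | ⟨q, A', h1, h2, h3, h4, h5⟩)
    · exact ⟨fun _ => (0, 0), fun p hp => hp.elim, fun p q hp => hp.elim⟩
    · obtain ⟨pos, hq, hin, hdisj⟩ := ih h2
      have hpar : ∀ p, p ≠ [] → parentPos e pos p = parentPos q pos p := fun p hp => by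
        simp [parentPos, hp]
      have hroot : ∀ p, IsNode t [] → IsNode t p → p ≠ [] →
          Disjoint (halfSegment q e) (halfSegment (pos p) (parentPos q pos p)) := by
        intro p h0 hp hne
        rw [Set.disjoint_left]
        intro z hz hzp
        obtain rfl := h5 z hz ((hin p hp).2 hzp)
        refine Set.disjoint_left.1 (hdisj [] p h0 hp (Ne.symm hne)) ?_ hzp
        rw [hq]
        exact self_mem_halfSegment _ _
      refine ⟨pos, fun p hp => ?_, fun p p' hp hp' hne => ?_⟩
      · by_cases hp0 : p = []
        · subst hp0
          simpa [parentPos, hq] using ⟨h1, h4⟩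
        · rw [hpar p hp0]
          exact ⟨(hin p hp).1, (hin p hp).2.trans h3⟩
      · by_cases hp0 : p = []
        · subst hp0
          rw [hpar p' hne.symm, hq, parentPos, if_pos rfl]
          exact hroot p' hp hp' hne.symm
        · by_cases hp0' : p' = []
          · subst hp0'
            rw [hpar p hne, hq, show parentPos e pos [] = e from if_pos rfl]
            exact (hroot p hp' hp hne).symm
          · rw [hpar p hp0, hpar p' hp0']
            exact hdisj p p' hp hp' hne
  induction t with
  | nil => exact fun {e} _ _ => ⟨fun _ => e, rfl, fun p hp => hp.elim, fun p q hp => hp.elim⟩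
  | node a l r ihl ihr =>
    rintro e R ⟨he, A, B, hA, hB, heA, heB, hd, hl, hr⟩
    obtain ⟨posl, hinl, hdl⟩ := hang l ihl hl
    obtain ⟨posr, hinr, hdr⟩ := hang r ihr hr
    let pos : List Bool → ℤ × ℤ
      | [] => e
      | false :: p => posl p
      | true :: p => posr p
    have hparl : ∀ p, parentPos e pos (false :: p) = parentPos e posl p := by
      rintro (_ | ⟨c, p⟩)
      · simp [parentPos, pos]
      · simp [parentPos, pos, List.dropLast_cons_cons]
    have hparr : ∀ p, parentPos e pos (true :: p) = parentPos e posr p := by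
      rintro (_ | ⟨c, p⟩)
      · simp [parentPos, pos]
      · simp [parentPos, pos, List.dropLast_cons_cons]
    -- The root acts as its own parent, so its degenerate segment is its position, and disjointness
    -- of segments also separates it from all other edges.
    have hpar0 : halfSegment (pos []) (parentPos e pos []) = {e} := halfSegment_self e
    refine ⟨pos, rfl, ?_, ?_⟩
    · rintro (_ | ⟨_ | _, p⟩) hp
      · rw [hpar0]
        exact ⟨.inl rfl, by simpa using he⟩
      · rw [hparl]
        exact ⟨(hinl p hp).1, (hinl p hp).2.trans hA⟩
      · rw [hparr]
        exact ⟨(hinr p hp).1, (hinr p hp).2.trans hB⟩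
    · rintro (_ | ⟨_ | _, p⟩) (_ | ⟨_ | _, q⟩) hp hq hne
      · exact absurd rfl hne
      · rw [hpar0, hparl, Set.disjoint_singleton_left]
        exact fun h => heA ((hinl q hq).2 h)
      · rw [hpar0, hparr, Set.disjoint_singleton_left]
        exact fun h => heB ((hinr q hq).2 h)
      · rw [hpar0, hparl, Set.disjoint_singleton_right]
        exact fun h => heA ((hinl p hp).2 h)
      · rw [hparl, hparl]
        exact hdl p q hp hq (by simpa using hne)
      · rw [hparl, hparr]
        exact hd.mono (hinl p hp).2 (hinr q hq).2
      · rw [hpar0, hparr, Set.disjoint_singleton_right]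
        exact fun h => heB ((hinr p hp).2 h)
      · rw [hparl, hparr]
        exact hd.symm.mono (hinr p hp).2 (hinl q hq).2
      · rw [hparr, hparr]
        exact hdr p q hp hq (by simpa using hne)

theorem mem_halfSegment_or_eq {q e z : ℤ × ℤ} (h1 : min q.1 e.1 ≤ z.1 ∧ z.1 ≤ max q.1 e.1)
    (h2 : min q.2 e.2 ≤ z.2 ∧ z.2 ≤ max q.2 e.2) : z ∈ halfSegment q e ∨ z = e := by
  by_cases h : z = e
  · exact .inr h
  · exact .inl (.inr ⟨h, h1, h2⟩)

theorem le_and_le_of_mem_segment {p q : ℤ × ℤ} {x : ℝ × ℝ}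
    (hx : x ∈ segment ℝ (toPlane p) (toPlane q)) :
    (((min p.1 q.1 : ℤ) : ℝ) ≤ x.1 ∧ x.1 ≤ ((max p.1 q.1 : ℤ) : ℝ)) ∧
      (((min p.2 q.2 : ℤ) : ℝ) ≤ x.2 ∧ x.2 ≤ ((max p.2 q.2 : ℤ) : ℝ)) := by
  have h := Prod.segment_subset (𝕜 := ℝ) _ _ hx
  rw [Set.mem_prod, segment_eq_uIcc, segment_eq_uIcc] at h
  push_cast
  exact h

/-- A discrete drawing of a tree yields a planar one. -/
theorem Drawn.exists_isPlanarStraightLineDrawing {t : BinaryTree Unit} {e : ℤ × ℤ} {W H : ℕ}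
    (h : Drawn t e (Set.Icc (1 : ℤ) W ×ˢ Set.Icc (1 : ℤ) H)) :
    ∃ pos : Vertex t → ℤ × ℤ, IsPlanarStraightLineDrawing (treeGraph t) W H pos ∧
      IsOrthogonal (treeGraph t) pos := by
  obtain ⟨pos, -, hin, hdisj⟩ := h.exists_hasDisjointEdges
  have hinj : ∀ v w : Vertex t, pos v.1 = pos w.1 → v = w := by
    intro v w hvw
    by_contra hne
    refine Set.disjoint_left.1 (hdisj v.1 w.1 v.2 w.2 fun h => hne (Subtype.ext h))
      (self_mem_halfSegment _ _) ?_
    rw [hvw]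
    exact self_mem_halfSegment _ _
  have hchild : ∀ u v : Vertex t, IsChild u v →
      u.1 ≠ [] ∧ v.1 = u.1.dropLast ∧ parentPos e pos u.1 = pos v.1 := by
    rintro u v ⟨b, hb⟩
    simp [hb, parentPos]
  have hpos : ∀ u v : Vertex t, u ≠ v → ∀ z ∈ halfSegment (pos u.1) (parentPos e pos u.1),
      z ∉ halfSegment (pos v.1) (parentPos e pos v.1) := fun u v huv z hz =>
    Set.disjoint_left.1 (hdisj u.1 v.1 u.2 v.2 fun h => huv (Subtype.ext h)) hz
  -- grid points that lie on an edge
  have hgrid : ∀ u v : Vertex t, IsChild u v → ∀ z : ℤ × ℤ,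
      (min (pos u.1).1 (pos v.1).1 ≤ z.1 ∧ z.1 ≤ max (pos u.1).1 (pos v.1).1) →
      (min (pos u.1).2 (pos v.1).2 ≤ z.2 ∧ z.2 ≤ max (pos u.1).2 (pos v.1).2) →
      z ∈ halfSegment (pos u.1) (parentPos e pos u.1) ∨ z = pos v.1 := by
    intro u v huv z h1 h2
    rw [(hchild u v huv).2.2]
    exact mem_halfSegment_or_eq h1 h2
  have hvertex : ∀ u v w : Vertex t, IsChild u v →
      toPlane (pos w.1) ∈ segment ℝ (toPlane (pos u.1)) (toPlane (pos v.1)) → w = u ∨ w = v := by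
    intro u v w huv hw
    have h1 := le_and_le_of_mem_segment hw
    simp only [toPlane, Int.cast_le] at h1
    rcases hgrid u v huv _ h1.1 h1.2 with h2 | h2
    · left
      by_contra hne
      exact hpos w u hne _ (self_mem_halfSegment _ _) h2
    · exact .inr (hinj _ _ h2)
  have hcommon : ∀ u v x y : Vertex t, IsChild u v → IsChild x y → u ≠ x → ∀ z : ℤ × ℤ,
      (min (pos u.1).1 (pos v.1).1 ≤ z.1 ∧ z.1 ≤ max (pos u.1).1 (pos v.1).1) →
      (min (pos u.1).2 (pos v.1).2 ≤ z.2 ∧ z.2 ≤ max (pos u.1).2 (pos v.1).2) →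
      (min (pos x.1).1 (pos y.1).1 ≤ z.1 ∧ z.1 ≤ max (pos x.1).1 (pos y.1).1) →
      (min (pos x.1).2 (pos y.1).2 ≤ z.2 ∧ z.2 ≤ max (pos x.1).2 (pos y.1).2) →
      ∃ w, (w = u ∨ w = v) ∧ (w = x ∨ w = y) ∧ z = pos w.1 := by
    intro u v x y huv hxy hux z h1 h2 h3 h4
    rcases hgrid u v huv z h1 h2 with h5 | h5 <;> rcases hgrid x y hxy z h3 h4 with h6 | h6
    · exact absurd h6 (hpos u x hux z h5)
    · refine ⟨y, .inl ?_, .inr rfl, h6⟩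
      by_contra hne
      exact hpos u y (Ne.symm hne) z h5 (h6 ▸ self_mem_halfSegment _ _)
    · refine ⟨v, .inr rfl, .inl ?_, h5⟩
      by_contra hne
      exact hpos x v (Ne.symm hne) z h6 (h5 ▸ self_mem_halfSegment _ _)
    · exact ⟨v, .inr rfl, .inr (hinj _ _ (h5.symm.trans h6)), h5⟩
  have hcross : ∀ u v x y : Vertex t, IsChild u v → IsChild x y → s(u, v) ≠ s(x, y) →
      ∀ p ∈ segment ℝ (toPlane (pos u.1)) (toPlane (pos v.1)) ∩
        segment ℝ (toPlane (pos x.1)) (toPlane (pos y.1)),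
      ∃ w, w ∈ s(u, v) ∧ w ∈ s(x, y) ∧ p = toPlane (pos w.1) := by
    rintro u v x y huv hxy hne p ⟨hp1, hp2⟩
    have hux : u ≠ x := by
      rintro rfl
      refine hne ?_
      rw [Subtype.ext ((hchild u v huv).2.1.trans (hchild u y hxy).2.1.symm)]
    obtain ⟨⟨a1, a2⟩, a3, a4⟩ := le_and_le_of_mem_segment hp1
    obtain ⟨⟨b1, b2⟩, b3, b4⟩ := le_and_le_of_mem_segment hp2
    have floor_bounds : ∀ {m M : ℤ} {a : ℝ}, (m : ℝ) ≤ a → a ≤ M → m ≤ ⌊a⌋ ∧ ⌊a⌋ ≤ M :=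
      fun h1 h2 => ⟨Int.le_floor.2 h1, by exact_mod_cast (Int.floor_le _).trans h2⟩
    have ceil_bounds : ∀ {m M : ℤ} {a : ℝ}, (m : ℝ) ≤ a → a ≤ M → m ≤ ⌈a⌉ ∧ ⌈a⌉ ≤ M :=
      fun h1 h2 => ⟨by exact_mod_cast h1.trans (Int.le_ceil _), Int.ceil_le.2 h2⟩
    -- Both segments have integral bounds, so rounding the common point down or up in both
    -- coordinates yields grid points of both edges, hence common endpoints. Distinct edges share at
    -- most one endpoint, so the roundings agree and the point is integral.
    obtain ⟨w, hw1, hw2, hw⟩ := hcommon u v x y huv hxy hux (⌊p.1⌋, ⌊p.2⌋)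
      (floor_bounds a1 a2) (floor_bounds a3 a4) (floor_bounds b1 b2) (floor_bounds b3 b4)
    obtain ⟨w', hw1', hw2', hw'⟩ := hcommon u v x y huv hxy hux (⌈p.1⌉, ⌈p.2⌉)
      (ceil_bounds a1 a2) (ceil_bounds a3 a4) (ceil_bounds b1 b2) (ceil_bounds b3 b4)
    have hww : w' = w := by
      by_contra hww
      exact hne (Sym2.eq_of_ne_mem hww (by simpa using hw1') (by simpa using hw1)
        (by simpa using hw2') (by simpa using hw2))
    rw [hww, ← hw, Prod.mk.injEq] at hw'
    have integral : ∀ a : ℝ, ⌈a⌉ = ⌊a⌋ → a = ⌊a⌋ := fun a ha =>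
      le_antisymm (by rw [← ha]; exact Int.le_ceil a) (Int.floor_le a)
    refine ⟨w, by simpa using hw1, by simpa using hw2, ?_⟩
    rw [← hw, toPlane]
    exact Prod.ext (integral _ hw'.1) (integral _ hw'.2)
  refine ⟨fun v => pos v.1, ⟨?_, ?_, ?_, ?_⟩, ?_⟩
  · exact fun v => (hin v.1 v.2).2 (self_mem_halfSegment _ _)
  · exact fun v w hvw => hinj v w hvw
  · rintro u v w (h | h) hw
    · rw [edgeSegment, segment_symm] at hw
      exact (hvertex v u w h hw).symm
    · exact hvertex u v w h hw
  · rintro u v x y h1 h2 hne p hp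
    simp only [edgeSegment] at hp
    rcases h1 with h1 | h1 <;> rcases h2 with h2 | h2
    · rw [segment_symm, segment_symm ℝ (toPlane (pos x.1))] at hp
      rw [Sym2.eq_swap, Sym2.eq_swap (a := x)] at hne ⊢
      exact hcross v u y x h1 h2 hne p hp
    · rw [segment_symm] at hp
      rw [Sym2.eq_swap] at hne ⊢
      exact hcross v u x y h1 h2 hne p hp
    · rw [segment_symm ℝ (toPlane (pos x.1))] at hp
      rw [Sym2.eq_swap (a := x)] at hne ⊢
      exact hcross u v y x h1 h2 hne p hp
    · exact hcross u v x y h1 h2 hne p hp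
  · have key : ∀ u v : Vertex t, IsChild u v → Aligned (pos u.1) (pos v.1) := fun u v huv => by
      rw [← (hchild u v huv).2.2]
      exact (hin u.1 u.2).1
    rintro u v (h | h)
    · exact (key v u h).imp Eq.symm Eq.symm
    · exact key u v h

theorem TreeInBox.exists_isPlanarStraightLineDrawing {t : BinaryTree Unit} {W H : ℕ}
    (h : TreeInBox t W H) :
    ∃ pos : Vertex t → ℤ × ℤ, IsPlanarStraightLineDrawing (treeGraph t) W H pos ∧
      IsOrthogonal (treeGraph t) pos := by
  refine ((Drawn.map (isGridSymmetry_translate 1 1) h).mono ?_).exists_isPlanarStraightLineDrawing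
  rintro ⟨x, y⟩
  simp only [box, translate, Equiv.coe_fn_symm_mk, Set.mem_preimage, Set.mem_ofPred_eq,
    Set.mem_prod, Set.mem_Icc]
  omega

/-! ### The area bound -/

theorem exists_treeInBox_area_le (t : BinaryTree Unit) :
    ∃ W H : ℕ, TreeInBox t W H ∧
      ((W * H : ℕ) : ℝ) ≤ t.numNodes * (2 : ℝ) ^ ((16 : ℝ) * (logStar t.numNodes : ℝ)) := by
  rcases Nat.eq_zero_or_pos t.numNodes with h0 | h0
  · refine ⟨0, 0, ?_, by simp [h0]⟩
    cases t with
    | nil => trivial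
    | node a l r => simp at h0
  -- One node is treated apart: there `log*` is `0`, which leaves no room for the factor `87`. From
  -- two nodes on, `87 ≤ 2 ^ 7` is absorbed into the exponent, and `16 = 7 + 9`.
  rcases Nat.lt_or_ge t.numNodes 2 with h1 | h1
  · have h1 : t.numNodes = 1 := by omega
    refine ⟨1, 1, fits_one.tree t (by omega), ?_⟩
    rw [h1, mul_one, Nat.cast_one, one_mul]
    exact Real.one_le_rpow (by norm_num) (by positivity)
  · have hmem : iterLog (logStar t.numNodes) t.numNodes ≤ 1 :=
      Nat.sInf_mem (exists_iterLog_le_one (t.numNodes : ℝ))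
    have hpos : 1 ≤ logStar t.numNodes := by
      by_contra hlt
      rw [show logStar t.numNodes = 0 by omega] at hmem
      simp only [iterLog, Function.iterate_zero, id] at hmem
      have : t.numNodes ≤ 1 := by exact_mod_cast hmem
      omega
    obtain ⟨W, H, hWH, htree⟩ := Fits.exists_treeInBox_of_iterLog_le (t := t)
      (logStar t.numNodes) (β := 0) (S := 1) (L := 1) (C := 1) fits_one (by norm_num) h0 (by simp)
      (by simpa using hmem)
    refine ⟨W, H, htree, ?_⟩
    generalize logStar t.numNodes = m at *
    have h2 : 87 * 1 * 512 ^ m * t.numNodes ≤ t.numNodes * 2 ^ (16 * m) := by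
      have h3 : 87 ≤ 2 ^ (7 * m) := by
        calc 87 ≤ 2 ^ (7 * 1) := by norm_num
          _ ≤ 2 ^ (7 * m) := Nat.pow_le_pow_right (by norm_num) (by omega)
      calc 87 * 1 * 512 ^ m * t.numNodes = t.numNodes * (87 * 512 ^ m) := by ring
        _ ≤ t.numNodes * (2 ^ (7 * m) * 512 ^ m) := by gcongr
        _ = t.numNodes * 2 ^ (16 * m) := by
          rw [show (512 : ℕ) = 2 ^ 9 by norm_num, ← pow_mul, ← pow_add]
          congr 2
          ring
    rw [show (16 : ℝ) * (m : ℝ) = ((16 * m : ℕ) : ℝ) by push_cast; ring, Real.rpow_natCast]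
    exact_mod_cast hWH.trans h2

end TreeDrawing

theorem mainTheorem5 :
    ∃ c : ℝ, ∀ (n : ℕ) (t : BinaryTree Unit), t.numNodes = n →
      ∃ (W H : ℕ) (pos : TreeDrawing.Vertex t → ℤ × ℤ),
        TreeDrawing.IsPlanarStraightLineDrawing (TreeDrawing.treeGraph t) W H pos ∧
        TreeDrawing.IsOrthogonal (TreeDrawing.treeGraph t) pos ∧
        ((W * H : ℕ) : ℝ) ≤ (n : ℝ) * (2 : ℝ) ^ (c * (TreeDrawing.logStar (n : ℝ) : ℝ)) := by
  refine ⟨16, ?_⟩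
  rintro n t rfl
  obtain ⟨W, H, htree, harea⟩ := TreeDrawing.exists_treeInBox_area_le t
  obtain ⟨pos, h1, h2⟩ := htree.exists_isPlanarStraightLineDrawing
  exact ⟨W, H, pos, h1, h2, harea⟩
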